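/- **Theorem (Communication complexity of Lasso).** For an $n\times d$ real matrix $M$, $b\in\mathbb R^n$ and $\lambda>0$ let $$\mathrm{Opt}_\lambda(M,b)=\min_{z\in\mathbb R^d}\ \|Mz-b\|_2^2+\lambda\|z\|_1 .$$ Alice holds an $n\times d$ matrix $M_1$, Bob holds an $n\times d$ matrix $M_2$, and $n,d,b,\lambda$ are known to both. In a public-coin randomized protocol they send bits to each other, each bit depending on the sender's matrix, the shared coins and the bits sent so far; at the end one of them, determined by the coins and the transcript, outputs a real number $v$ depending on that party's matrix, the coins and the transcript. The protocol $(1+c)$-approximates the optimum with error $\varepsilon$ on a set of input pairs if for every pair $(M_1,M_2)$ in the set, with probability at least $1-\varepsilon$, $$(1-c)\,\mathrm{Opt}_\lambda(M_1+M_2,b)\le v\le(1+c)\,\mathrm{Opt}_\lambda(M_1+M_2,b).$$ There is an absolute constant $c_0>0$ such that for every $\varepsilon\in(0,1/2)$ there are $\kappa>0$ and $d_0$, depending only on $\varepsilon$, with the following properties. 1. For every $n\ge1$ there is $b\in\{0,1\}^n$ such that for all $0<\lambda<1$, $0<c\le c_0$ and $d\ge d_0$, every public-coin randomized protocol that $(1+c)$-approximates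 the optimum with error $\varepsilon$ on all pairs $M_1,M_2\in\{0,1\}^{n\times d}$ (in particular, every protocol that does so on all pairs of real $n\times d$ matrices) exchanges at least $\kappa d$ bits for some such pair and some outcome of the coins. That is, $\Omega(d)$ bits are required in the worst case. 2. The same bound $\kappa d$ holds, for all $0<\lambda<1$, $0<c\le c_0$ and $d\ge d_0$, for $n=2$, $b=(1,1)^{T}$ and protocols that need to be correct only on the following inputs: for sets $A,B\subseteq\{1,\dots,d\}$, the first row of $M_1$ is the indicator vector of $A$, the second row of $M_2$ is the indicator vector of $B$, and the other two rows are zero. The worst case is again taken over these inputs and the coins. Moreover, for every $0<\lambda<1$, every $d$ and all $A,B\subseteq\{1,\dots,d\}$, the matrices $M_1,M_2$ of item 2 satisfy $\mathrm{Opt}_\lambda(M_1+M_2,(1,1)^T)\le\lambda$ if $A\cap B\neq\emptyset$, and $\mathrm{Opt}_\lambda(M_1+M_2,(1,1)^T)\ge 3\lambda/2$ if $A\cap B=\emptyset$. -/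

import Mathlib

open MeasureTheory

universe u

/-- Deterministic two-party protocols on inputs `x : X` (held by Alice) and `y : Y` (held by Bob),
with answers in `Z`. At an inner node one party announces one bit, computed from its own input (and
from the node, i.e. from all bits announced so far). At a leaf, the party named by the leaf gives
the answer, which may depend on that party's own input; a leaf with a fixed label is the case of a
constant `g`. -/
inductive Protocol (X Y Z : Type) : Type
  | answerAlice (g : X → Z) : Protocol X Y Z
  | answerBob (g : Y → Z) : Protocol X Y Z
  | sayAlice (m : X → Bool) (next : Bool → Protocol X Y Z) : Protocol X Y Z
  | sayBob (m : Y → Bool) (next : Bool → Protocol X Y Z) : Protocol X Y Z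

namespace Protocol

variable {X Y Z : Type}

/-- The answer given by the protocol on the input pair `(x, y)`. -/
def run : Protocol X Y Z → X → Y → Z
  | answerAlice g, x, _ => g x
  | answerBob g, _, y => g y
  | sayAlice m next, x, y => run (next (m x)) x y
  | sayBob m next, x, y => run (next (m y)) x y

/-- The number of bits exchanged by the protocol on the input pair `(x, y)`. -/
def bits : Protocol X Y Z → X → Y → ℕ
  | answerAlice _, _, _ => 0
  | answerBob _, _, _ => 0
  | sayAlice m next, x, y => bits (next (m x)) x y + 1
  | sayBob m next, x, y => bits (next (m y)) x y + 1

end Protocol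

noncomputable section

/-- The Lasso objective `‖M z - b‖₂² + lam ‖z‖₁`. -/
def lassoObjective {n d : ℕ} (M : Matrix (Fin n) (Fin d) ℝ) (b : Fin n → ℝ) (lam : ℝ)
    (z : Fin d → ℝ) : ℝ :=
  ‖WithLp.toLp 2 (M.mulVec z - b)‖ ^ 2 + lam * ‖WithLp.toLp 1 z‖

/-- The optimal value of the Lasso problem (the objective is bounded below by `0` for `0 ≤ lam`). -/
def lassoOpt {n d : ℕ} (M : Matrix (Fin n) (Fin d) ℝ) (b : Fin n → ℝ) (lam : ℝ) : ℝ :=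
  ⨅ z : Fin d → ℝ, lassoObjective M b lam z

/-- Protocols for Lasso: Alice holds `M₁`, Bob holds `M₂`, the answer is a real number. -/
abbrev LassoProtocol (n d : ℕ) : Type :=
  Protocol (Matrix (Fin n) (Fin d) ℝ) (Matrix (Fin n) (Fin d) ℝ) ℝ

/-- A public-coin randomized protocol is a family `P` of deterministic protocols indexed by the
outcome `ω` of the coins, which has law `μ` (private coins may be part of `ω`). It
`(1 ± c)`-approximates the Lasso optimum with error `ε` on the inputs in `S` if on each such input
the probability that the answer is outside `[(1 - c) Opt, (1 + c) Opt]` is at most `ε`. (For a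
non-measurable failure event, `μ` is the outer measure.) -/
def ApproximatesLasso {Ω : Type u} [MeasurableSpace Ω] (μ : Measure Ω) {n d : ℕ}
    (P : Ω → LassoProtocol n d)
    (S : Set (Matrix (Fin n) (Fin d) ℝ × Matrix (Fin n) (Fin d) ℝ))
    (b : Fin n → ℝ) (lam c ε : ℝ) : Prop :=
  ∀ M₁ M₂, (M₁, M₂) ∈ S →
    μ {ω | ¬ |(P ω).run M₁ M₂ - lassoOpt (M₁ + M₂) b lam| ≤ c * lassoOpt (M₁ + M₂) b lam}
      ≤ ENNReal.ofReal ε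

/-- Every public-coin randomized protocol that approximates the Lasso optimum on the inputs in `S`
exchanges at least `B` bits in the worst case over the inputs in `S` and the coins. -/
def LassoRequiresBits {n d : ℕ}
    (S : Set (Matrix (Fin n) (Fin d) ℝ × Matrix (Fin n) (Fin d) ℝ))
    (b : Fin n → ℝ) (lam c ε B : ℝ) : Prop :=
  ∀ (Ω : Type u) [MeasurableSpace Ω] (μ : Measure Ω) [IsProbabilityMeasure μ]
    (P : Ω → LassoProtocol n d),
    ApproximatesLasso μ P S b lam c ε →
      ∃ M₁ M₂, (M₁, M₂) ∈ S ∧ ∃ ω, B ≤ ((P ω).bits M₁ M₂ : ℝ)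

/-- Pairs of matrices with entries in `{0, 1}`. -/
def binaryInputs (n d : ℕ) : Set (Matrix (Fin n) (Fin d) ℝ × Matrix (Fin n) (Fin d) ℝ) :=
  {p | (∀ i j, p.1 i j = 0 ∨ p.1 i j = 1) ∧ ∀ i j, p.2 i j = 0 ∨ p.2 i j = 1}

/-- The `2 × d` matrix whose row `r` is the indicator vector of `A` and whose other row is zero. -/
def rowIndicator {d : ℕ} (r : Fin 2) (A : Finset (Fin d)) : Matrix (Fin 2) (Fin d) ℝ :=
  Matrix.of fun i j => if i = r ∧ j ∈ A then 1 else 0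

/-- Inputs coming from Set Disjointness: the first row of `M₁ + M₂` (from Alice) is the indicator
of a set `A`, its second row (from Bob) is the indicator of a set `B`. -/
def disjointnessInputs (d : ℕ) : Set (Matrix (Fin 2) (Fin d) ℝ × Matrix (Fin 2) (Fin d) ℝ) :=
  {p | ∃ A B : Finset (Fin d), p = (rowIndicator 0 A, rowIndicator 1 B)}

end

/-!
The lower bound comes from Set Disjointness. If `A` and `B` share an element `j`, then column `j` of
`M₁ + M₂` is proportional to `b`, and a multiple of the `j`-th unit vector has zero residual and
small `ℓ₁` norm. If they are disjoint, every unit of `ℓ₁` norm serves at most one unit of the target,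
and the optimum is larger by a factor of at least `3 / 2` (`lassoOpt_le_of_mul_col_eq`,
`card_mul_le_lassoOpt`). For binary inputs with any number of rows, `b = e₀` and both
indicator vectors are in row `0`, so that a common element gives an entry `2`. A good
approximation of the optimum thus decides disjointness
(`lassoRequiresBits_of_encoding`).

The linear lower bound for Set Disjointness is an information cost argument with Hellinger distances.
Each coordinate is assigned at random to one of the parties, who holds a random bit there while the
other party holds `0`; this gives disjoint sets, and planting `1` for both parties at a random
coordinate `i` gives sets that meet exactly in `i`. For a fixed assignment the inputs form a Boolean
cube, which the transcripts cut into few parts. As the parts are few, they are large on average,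
and the bits have little total bias on a large set (`level_one_inequality`), so
changing one bit of one party at a random coordinate hardly changes the law of the transcript (`sum_hellingerSq_condLaw_le`). As the
parts are rectangles, the laws for `(0, 0)` and `(1, 1)` at coordinate `i` are as close as those for
`(0, 1)` and `(1, 0)` (`condLaw_mul_condLaw`), hence the planted intersection is hardly noticed
(`sq_sum_advantage_le`). Averaging over the coins reduces randomized protocols to deterministic ones
(`exists_expect_indicator_le`), and since the argument bounds the advantage itself it applies to every
error below `1 / 2` without amplification.
-/

open Finset Function
open scoped BigOperators

/-! ### Fourier weight at level one on the Boolean cube -/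

/-- The sign `(-1)^b` of a bit. -/
def bitSign (b : Bool) : ℝ := if b then -1 else 1

section Cube

variable {ι : Type} [Fintype ι] [DecidableEq ι]

lemma expect_exp_sum_bitSign (t : ι → ℝ) :
    𝔼 z : ι → Bool, Real.exp (∑ i, t i * bitSign (z i)) = ∏ i, Real.cosh (t i) := by
  rw [Fintype.expect_eq_sum_div_card]
  simp_rw [Real.exp_sum]
  rw [← Fintype.piFinset_univ, ← Finset.prod_univ_sum (fun _ => Finset.univ)
    (fun i b => Real.exp (t i * bitSign b))]
  have h : ∀ i, ∑ b : Bool, Real.exp (t i * bitSign b) = Real.cosh (t i) * 2 := fun i => by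
    simp [bitSign, Real.cosh_eq]
    ring
  simp_rw [h, Finset.prod_mul_distrib]
  simp

/-- The level-one inequality: a set of density `m` in the Boolean cube has level-one Fourier weight
at most `2 m² log (1 / m)`. It follows from comparing the exponential moment of
`∑ i, b i * (-1) ^ z i` on the whole cube (at most `exp (∑ i, b i ^ 2 / 2)`) with its part on the
set (at least `m * exp (∑ i, b i ^ 2)` by convexity), where `b i` is the bias of the `i`-th bit on
the set. -/
lemma level_one_inequality (p : (ι → Bool) → Prop) [DecidablePred p] :
    ∑ i, (𝔼 z : ι → Bool, (if p z then (1 : ℝ) else 0) * bitSign (z i)) ^ 2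
        / (𝔼 z : ι → Bool, if p z then (1 : ℝ) else 0)
      ≤ 2 * Real.negMulLog (𝔼 z : ι → Bool, if p z then (1 : ℝ) else 0) := by
  set g : (ι → Bool) → ℝ := fun z => if p z then 1 else 0 with hg
  set m : ℝ := 𝔼 z : ι → Bool, g z with hm
  have hg0 : ∀ z, 0 ≤ g z := fun z => by simp only [hg]; split_ifs <;> norm_num
  have hg1 : ∀ z, g z ≤ 1 := fun z => by simp only [hg]; split_ifs <;> norm_num
  have hm0 : 0 ≤ m := Finset.expect_nonneg fun z _ => hg0 z
  rcases hm0.eq_or_lt with h0 | hpos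
  · rw [← h0]; simp
  set b : ι → ℝ := fun i => (𝔼 z : ι → Bool, g z * bitSign (z i)) / m with hb
  set B : ℝ := ∑ i, b i ^ 2 with hB
  have hlin : 𝔼 z : ι → Bool, g z * ∑ i, b i * bitSign (z i) = m * B := by
    simp_rw [Finset.mul_sum]
    rw [Finset.expect_sum_comm, hB, Finset.mul_sum]
    refine Finset.sum_congr rfl fun i _ => ?_
    have : ∀ z : ι → Bool, g z * (b i * bitSign (z i)) = b i * (g z * bitSign (z i)) :=
      fun z => by ring
    simp_rw [this]
    rw [← Finset.mul_expect]
    have : 𝔼 z : ι → Bool, g z * bitSign (z i) = b i * m := by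
      simp only [hb]; field_simp
    rw [this]; ring
  have hlow : Real.exp B * m ≤ 𝔼 z : ι → Bool, Real.exp (∑ i, b i * bitSign (z i)) := by
    have e1 : Real.exp B * m
        = 𝔼 z : ι → Bool, Real.exp B * (g z * (1 - B) + g z * ∑ i, b i * bitSign (z i)) := by
      rw [← Finset.mul_expect, Finset.expect_add_distrib, hlin, ← Finset.expect_mul]
      change _ = Real.exp B * (m * (1 - B) + m * B)
      ring
    rw [e1]
    refine Finset.expect_le_expect fun z _ => ?_
    set u := ∑ i, b i * bitSign (z i)
    have h1 : Real.exp B * (1 - B + u) ≤ Real.exp u := by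
      have h2 := Real.add_one_le_exp (u - B)
      have h3 : Real.exp u = Real.exp B * Real.exp (u - B) := by
        rw [← Real.exp_add]; ring_nf
      rw [h3]
      exact mul_le_mul_of_nonneg_left (by linarith) (Real.exp_pos _).le
    calc Real.exp B * (g z * (1 - B) + g z * u) = g z * (Real.exp B * (1 - B + u)) := by ring
      _ ≤ g z * Real.exp u := mul_le_mul_of_nonneg_left h1 (hg0 z)
      _ ≤ Real.exp u := mul_le_of_le_one_left (Real.exp_pos _).le (hg1 z)
  have hup : 𝔼 z : ι → Bool, Real.exp (∑ i, b i * bitSign (z i)) ≤ Real.exp (B / 2) := by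
    rw [expect_exp_sum_bitSign, hB, Finset.sum_div, Real.exp_sum]
    exact Finset.prod_le_prod (fun i _ => (Real.cosh_pos _).le)
      fun i _ => Real.cosh_le_exp_half_sq _
  have hlog : B / 2 ≤ -Real.log m := by
    have h1 := Real.log_le_log (mul_pos (Real.exp_pos B) hpos) (hlow.trans hup)
    rw [Real.log_mul (Real.exp_pos B).ne' hpos.ne', Real.log_exp, Real.log_exp] at h1
    linarith
  have hsum : ∑ i, (𝔼 z : ι → Bool, g z * bitSign (z i)) ^ 2 / m = m * B := by
    rw [hB, Finset.mul_sum]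
    refine Finset.sum_congr rfl fun i _ => ?_
    simp only [hb]; field_simp
  rw [hsum, Real.negMulLog]
  nlinarith

lemma expect_eq_half_add_update (G : (ι → Bool) → ℝ) (i : ι) :
    𝔼 z, G z = (𝔼 z, G (update z i false) + 𝔼 z, G (update z i true)) / 2 := by
  have hflip : 𝔼 z, G z = 𝔼 z, G (update z i (!z i)) := by
    have hinv : Involutive fun z : ι → Bool => update z i (!z i) := fun z => by simp
    exact (Fintype.expect_bijective _ hinv.bijective _ _ fun _ => rfl).symm
  have h : 𝔼 z, G z + 𝔼 z, G (update z i (!z i))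
      = 𝔼 z, G (update z i false) + 𝔼 z, G (update z i true) := by
    rw [← Finset.expect_add_distrib, ← Finset.expect_add_distrib]
    refine Finset.expect_congr rfl fun z _ => ?_
    have hz : update z i (z i) = z := update_eq_self i z
    cases hi : z i <;> rw [hi] at hz <;> simp [hz, add_comm]
  rw [← hflip] at h
  linarith

lemma expect_mul_bitSign (G : (ι → Bool) → ℝ) (i : ι) :
    𝔼 z, G z * bitSign (z i)
      = (𝔼 z, G (update z i false) - 𝔼 z, G (update z i true)) / 2 := by
  rw [expect_eq_half_add_update _ i]
  simp [bitSign, Finset.expect_neg_distrib, sub_eq_add_neg]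

end Cube

/-! ### Hellinger distance of finite distributions -/

section Hellinger

variable {T : Type} [Fintype T]

lemma sum_negMulLog_le_log_card (m : T → ℝ) (h0 : ∀ t, 0 ≤ m t) (h1 : ∑ t, m t = 1) :
    ∑ t, Real.negMulLog (m t) ≤ Real.log (Fintype.card T) := by
  have hne : Nonempty T := by
    by_contra h
    rw [not_nonempty_iff] at h
    simp at h1
  have hL : (0 : ℝ) < Fintype.card T := by exact_mod_cast Fintype.card_pos
  set L : ℝ := ((Fintype.card T : ℕ) : ℝ) with hLdef
  have key : ∀ t, Real.negMulLog (m t) ≤ m t * Real.log L + (1 / L - m t) := fun t => by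
    rcases (h0 t).eq_or_lt with h | h
    · rw [← h]; simp [hL.le]
    · have h2 := Real.log_le_sub_one_of_pos (x := 1 / (L * m t)) (by positivity)
      rw [one_div, Real.log_inv, Real.log_mul hL.ne' h.ne'] at h2
      have h3 := mul_le_mul_of_nonneg_left h2 h.le
      have h4 : m t * ((L * m t)⁻¹ - 1) = 1 / L - m t := by field_simp
      rw [Real.negMulLog]
      linarith
  calc ∑ t, Real.negMulLog (m t) ≤ ∑ t, (m t * Real.log L + (1 / L - m t)) :=
        Finset.sum_le_sum fun t _ => key t
    _ = Real.log L := by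
        rw [Finset.sum_add_distrib, ← Finset.sum_mul, Finset.sum_sub_distrib, h1]
        simp only [Finset.sum_const, Finset.card_univ, nsmul_eq_mul, ← hLdef]
        field_simp
        ring

/-- Twice the squared Hellinger distance of the vectors `p` and `q` of probabilities. -/
noncomputable def hellingerSq (p q : T → ℝ) : ℝ := ∑ t, (√(p t) - √(q t)) ^ 2

lemma hellingerSq_triangle (p q r : T → ℝ) :
    hellingerSq p r ≤ 2 * (hellingerSq q p + hellingerSq q r) := by
  unfold hellingerSq
  rw [← Finset.sum_add_distrib, Finset.mul_sum]
  refine Finset.sum_le_sum fun t _ => ?_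
  nlinarith [sq_nonneg (√(p t) + √(r t) - 2 * √(q t))]

lemma hellingerSq_eq (p q : T → ℝ) (hp : ∀ t, 0 ≤ p t) (hq : ∀ t, 0 ≤ q t)
    (hp1 : ∑ t, p t = 1) (hq1 : ∑ t, q t = 1) :
    hellingerSq p q = 2 - 2 * ∑ t, √(p t * q t) := by
  have h : ∀ t, (√(p t) - √(q t)) ^ 2 = p t + q t - 2 * √(p t * q t) := fun t => by
    rw [Real.sqrt_mul (hp t), sub_sq, Real.sq_sqrt (hp t), Real.sq_sqrt (hq t)]; ring
  simp_rw [hellingerSq, h]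
  rw [Finset.sum_sub_distrib, Finset.sum_add_distrib, hp1, hq1, Finset.mul_sum]
  norm_num

lemma sq_sum_abs_sub_le_hellingerSq (p q : T → ℝ) (hp : ∀ t, 0 ≤ p t) (hq : ∀ t, 0 ≤ q t)
    (hp1 : ∑ t, p t = 1) (hq1 : ∑ t, q t = 1) :
    (∑ t, |p t - q t|) ^ 2 ≤ 4 * hellingerSq p q := by
  have h : ∀ t, |p t - q t| = |√(p t) - √(q t)| * (√(p t) + √(q t)) := fun t => by
    rw [← abs_of_nonneg (add_nonneg (Real.sqrt_nonneg (p t)) (Real.sqrt_nonneg (q t))),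
      ← abs_mul]
    congr 1
    nlinarith [Real.sq_sqrt (hp t), Real.sq_sqrt (hq t)]
  simp_rw [h]
  refine (Finset.sum_mul_sq_le_sq_mul_sq _ _ _).trans ?_
  simp_rw [sq_abs]
  rw [mul_comm, ← hellingerSq]
  refine mul_le_mul_of_nonneg_right ?_ (Finset.sum_nonneg fun t _ => sq_nonneg _)
  calc ∑ t, (√(p t) + √(q t)) ^ 2 ≤ ∑ t, (2 * p t + 2 * q t) := by
        refine Finset.sum_le_sum fun t _ => ?_
        nlinarith [Real.sq_sqrt (hp t), Real.sq_sqrt (hq t), sq_nonneg (√(p t) - √(q t))]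
    _ = 4 := by
        rw [Finset.sum_add_distrib, ← Finset.mul_sum, ← Finset.mul_sum, hp1, hq1]; norm_num

lemma sq_sqrt_sub_sqrt_le {p q : ℝ} (hp : 0 ≤ p) (hq : 0 ≤ q) :
    (√p - √q) ^ 2 ≤ 2 * (((p - q) / 2) ^ 2 / ((p + q) / 2)) := by
  rcases (add_nonneg hp hq).eq_or_lt with h | h
  · have hp' : p = 0 := by linarith
    have hq' : q = 0 := by linarith
    simp [hp', hq']
  · have e : 2 * (((p - q) / 2) ^ 2 / ((p + q) / 2)) = (p - q) ^ 2 / (p + q) := by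
      field_simp
    rw [e, le_div_iff₀ h]
    have h1 : p - q = (√p - √q) * (√p + √q) := by
      nlinarith [Real.sq_sqrt hp, Real.sq_sqrt hq]
    have h2 : p + q ≤ (√p + √q) ^ 2 := by
      nlinarith [Real.sq_sqrt hp, Real.sq_sqrt hq, mul_nonneg (Real.sqrt_nonneg p)
        (Real.sqrt_nonneg q)]
    rw [h1, mul_pow]
    exact mul_le_mul_of_nonneg_left h2 (sq_nonneg _)

end Hellinger

/-! ### The hard distribution for Set Disjointness -/

section Disjointness

variable {ι T : Type}

/-- The random input of Alice: the part of the random bits `z` on the coordinates that `D` assigns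
to Alice, and `0` elsewhere. -/
def aliceInput (D z : ι → Bool) : ι → Bool := fun k => D k && z k

/-- The random input of Bob: the part of the random bits `z` on the coordinates that `D` assigns
to Bob, and `0` elsewhere. -/
def bobInput (D z : ι → Bool) : ι → Bool := fun k => !D k && z k

/-- The fibres of `τ` are combinatorial rectangles. Apart from the number of values, this is the
only property of the map from inputs to transcripts that the lower bound uses. -/
def IsRectangular {X Y : Type} (τ : X → Y → T) : Prop :=
  ∀ x y x' y', τ x y = τ x' y' → τ x y' = τ x y

variable [Fintype ι] [DecidableEq ι] [DecidableEq T]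

/-- The law of `τ x y` when `x` and `y` are the random inputs determined by the assignment `D` of
coordinates to the parties, except that their `i`-th coordinates are fixed to `a` and `b`. -/
noncomputable def condLaw (τ : (ι → Bool) → (ι → Bool) → T) (i : ι) (D : ι → Bool) (a b : Bool)
    (t : T) : ℝ :=
  𝔼 z, if τ (update (aliceInput D z) i a) (update (bobInput D z) i b) = t then 1 else 0

variable (τ : (ι → Bool) → (ι → Bool) → T) (i : ι) (D : ι → Bool)

lemma condLaw_nonneg (a b : Bool) (t : T) : 0 ≤ condLaw τ i D a b t :=
  Finset.expect_nonneg fun z _ => by split_ifs <;> norm_num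

lemma sum_condLaw_mul [Fintype T] (a b : Bool) (f : T → ℝ) :
    ∑ t, condLaw τ i D a b t * f t
      = 𝔼 z, f (τ (update (aliceInput D z) i a) (update (bobInput D z) i b)) := by
  simp_rw [condLaw, Finset.expect_mul]
  rw [← Finset.expect_sum_comm]
  simp

lemma sum_condLaw [Fintype T] (a b : Bool) : ∑ t, condLaw τ i D a b t = 1 := by
  have h := sum_condLaw_mul τ i D a b fun _ => 1
  simpa [Fintype.expect_const] using h

lemma condLaw_update (c a b : Bool) : condLaw τ i (update D i c) a b = condLaw τ i D a b := by
  have hA : ∀ z, update (aliceInput (update D i c) z) i a = update (aliceInput D z) i a :=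
    fun z => by
      ext k
      by_cases hk : k = i
      · subst hk; simp
      · simp [aliceInput, hk]
  have hB : ∀ z, update (bobInput (update D i c) z) i b = update (bobInput D z) i b :=
    fun z => by
      ext k
      by_cases hk : k = i
      · subst hk; simp
      · simp [bobInput, hk]
  funext t
  simp only [condLaw, hA, hB]

/-- For a fixed assignment of coordinates, the inputs of the two parties are independent. -/
lemma expect_alice_mul_bob (f g : (ι → Bool) → ℝ) :
    𝔼 z, f (aliceInput D z) * g (bobInput D z)
      = (𝔼 z, f (aliceInput D z)) * 𝔼 z, g (bobInput D z) := by
  -- Exchanging Bob's coordinates of two independent samples is a measure-preserving involution.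
  let e : (ι → Bool) × (ι → Bool) → (ι → Bool) × (ι → Bool) := fun w =>
    (fun k => if D k then w.1 k else w.2 k, fun k => if D k then w.2 k else w.1 k)
  have he : Involutive e := fun w => by
    ext k <;> by_cases h : D k <;> simp [e, h]
  have h1 : 𝔼 w : (ι → Bool) × (ι → Bool), f (aliceInput D w.1) * g (bobInput D w.2)
      = 𝔼 w : (ι → Bool) × (ι → Bool), f (aliceInput D w.1) * g (bobInput D w.1) := by
    refine Fintype.expect_bijective e he.bijective _ _ fun w => ?_
    have hA : aliceInput D (e w).1 = aliceInput D w.1 := by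
      ext k; by_cases h : D k <;> simp [aliceInput, e, h]
    have hB : bobInput D (e w).1 = bobInput D w.2 := by
      ext k; by_cases h : D k <;> simp [bobInput, e, h]
    rw [hA, hB]
  rw [← Finset.univ_product_univ, Finset.expect_product, Finset.expect_product] at h1
  rw [Fintype.expect_mul_expect, h1]
  simp

/-- The cut-and-paste property: the laws for the four values of the `i`-th coordinates have
product form. -/
lemma condLaw_mul_condLaw (hτ : IsRectangular τ) (t : T) :
    condLaw τ i D false false t * condLaw τ i D true true t
      = condLaw τ i D false true t * condLaw τ i D true false t := by
  classical
  let α : Bool → ℝ := fun a =>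
    𝔼 z, if ∃ y, τ (update (aliceInput D z) i a) y = t then (1 : ℝ) else 0
  let β : Bool → ℝ := fun b =>
    𝔼 z, if ∃ x, τ x (update (bobInput D z) i b) = t then (1 : ℝ) else 0
  have h : ∀ a b, condLaw τ i D a b t = α a * β b := fun a b => by
    have h1 := expect_alice_mul_bob D
      (fun x => if ∃ y, τ (update x i a) y = t then (1 : ℝ) else 0)
      (fun y => if ∃ x, τ x (update y i b) = t then (1 : ℝ) else 0)
    rw [condLaw]
    refine Eq.trans (Finset.expect_congr rfl fun z _ => ?_) h1
    rw [ite_zero_mul_ite_zero, mul_one]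
    refine if_congr ⟨fun h => ⟨⟨_, h⟩, ⟨_, h⟩⟩, ?_⟩ rfl rfl
    rintro ⟨⟨y, hy⟩, ⟨x, hx⟩⟩
    exact (hτ _ _ _ _ (hy.trans hx.symm)).trans hy
  simp only [h]
  ring

/-- The information cost bound: for every assignment of coordinates, changing the bit of the party
in charge of a random coordinate changes the law of `τ` little on average, as `τ` takes few
values. The fibres of `τ` are subsets of the cube of all `z`, and the level-one inequality bounds the
total bias of the bits of `z` on them. -/
lemma sum_hellingerSq_condLaw_le [Fintype T] :
    ∑ i, hellingerSq (condLaw τ i D false false) (condLaw τ i D (D i) (!D i))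
      ≤ 4 * Real.log (Fintype.card T) := by
  let m : T → ℝ := fun t => 𝔼 z, if τ (aliceInput D z) (bobInput D z) = t then (1 : ℝ) else 0
  have hfalse : ∀ i t, 𝔼 z, (if τ (aliceInput D (update z i false))
      (bobInput D (update z i false)) = t then (1 : ℝ) else 0)
      = condLaw τ i D false false t := fun i t => by
    refine Finset.expect_congr rfl fun z _ => ?_
    have hA : aliceInput D (update z i false) = update (aliceInput D z) i false := by
      ext k; by_cases hk : k = i
      · subst hk; simp [aliceInput]
      · simp [aliceInput, hk]
    have hB : bobInput D (update z i false) = update (bobInput D z) i false := by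
      ext k; by_cases hk : k = i
      · subst hk; simp [bobInput]
      · simp [bobInput, hk]
    rw [hA, hB]
  have htrue : ∀ i t, 𝔼 z, (if τ (aliceInput D (update z i true))
      (bobInput D (update z i true)) = t then (1 : ℝ) else 0)
      = condLaw τ i D (D i) (!D i) t := fun i t => by
    refine Finset.expect_congr rfl fun z _ => ?_
    have hA : aliceInput D (update z i true) = update (aliceInput D z) i (D i) := by
      ext k; by_cases hk : k = i
      · subst hk; simp [aliceInput]
      · simp [aliceInput, hk]
    have hB : bobInput D (update z i true) = update (bobInput D z) i (!D i) := by
      ext k; by_cases hk : k = i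
      · subst hk; simp [bobInput]
      · simp [bobInput, hk]
    rw [hA, hB]
  have hm0 : ∀ t, 0 ≤ m t := fun t => Finset.expect_nonneg fun z _ => by split_ifs <;> norm_num
  have hm1 : ∑ t, m t = 1 := by
    simp only [m]
    rw [← Finset.expect_sum_comm]
    simp
  calc ∑ i, hellingerSq (condLaw τ i D false false) (condLaw τ i D (D i) (!D i))
      ≤ ∑ i, ∑ t, 2 * ((𝔼 z : ι → Bool,
          (if τ (aliceInput D z) (bobInput D z) = t then (1 : ℝ) else 0) * bitSign (z i)) ^ 2
            / m t) := by
        refine Finset.sum_le_sum fun i _ => Finset.sum_le_sum fun t _ => ?_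
        have e1 := expect_mul_bitSign
          (fun z => if τ (aliceInput D z) (bobInput D z) = t then (1 : ℝ) else 0) i
        have e2 : m t = _ := expect_eq_half_add_update
          (fun z => if τ (aliceInput D z) (bobInput D z) = t then (1 : ℝ) else 0) i
        rw [e1, e2, hfalse, htrue]
        exact sq_sqrt_sub_sqrt_le (condLaw_nonneg ..) (condLaw_nonneg ..)
    _ ≤ ∑ t, 2 * (2 * Real.negMulLog (m t)) := by
        rw [Finset.sum_comm]
        refine Finset.sum_le_sum fun t _ => ?_
        rw [← Finset.mul_sum]
        exact mul_le_mul_of_nonneg_left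
          (level_one_inequality fun z => τ (aliceInput D z) (bobInput D z) = t) (by norm_num)
    _ ≤ 4 * Real.log (Fintype.card T) := by
        rw [← Finset.mul_sum, ← Finset.mul_sum]
        linarith [sum_negMulLog_le_log_card m hm0 hm1]

/-- On average over `D`, the laws for `(0, 0)` and `(1, 1)` at coordinate `i` are close: by
cut-and-paste their distance is that of the laws for `(0, 1)` and `(1, 0)`, both of which are close
to the law for `(0, 0)`. -/
lemma sum_expect_hellingerSq_le [Fintype T] (hτ : IsRectangular τ) :
    ∑ i, 𝔼 D, hellingerSq (condLaw τ i D false false) (condLaw τ i D true true)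
      ≤ 16 * Real.log (Fintype.card T) := by
  have hstep : ∀ i, 𝔼 D, hellingerSq (condLaw τ i D false false) (condLaw τ i D true true)
      ≤ 4 * 𝔼 D, hellingerSq (condLaw τ i D false false) (condLaw τ i D (D i) (!D i)) :=
    fun i => by
      -- None of the laws depends on `D i`, so averaging over `D i` alone lets either party move.
      rw [expect_eq_half_add_update (fun D => hellingerSq (condLaw τ i D false false)
        (condLaw τ i D (D i) (!D i))) i]
      simp only [condLaw_update, update_self, Bool.not_false, Bool.not_true]
      rw [← Finset.expect_add_distrib]
      have : ∀ x : ℝ, 4 * (x / 2) = 2 * x := fun x => by ring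
      rw [this, Finset.mul_expect]
      refine Finset.expect_le_expect fun D _ => ?_
      have hcut : hellingerSq (condLaw τ i D false false) (condLaw τ i D true true)
          = hellingerSq (condLaw τ i D false true) (condLaw τ i D true false) := by
        have h0 := condLaw_nonneg τ i D
        have h1 := sum_condLaw τ i D
        rw [hellingerSq_eq _ _ (h0 _ _) (h0 _ _) (h1 _ _) (h1 _ _),
          hellingerSq_eq _ _ (h0 _ _) (h0 _ _) (h1 _ _) (h1 _ _)]
        simp_rw [condLaw_mul_condLaw τ i D hτ]
      rw [hcut]
      exact hellingerSq_triangle _ _ _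
  calc ∑ i, 𝔼 D, hellingerSq (condLaw τ i D false false) (condLaw τ i D true true)
      ≤ ∑ i, 4 * 𝔼 D, hellingerSq (condLaw τ i D false false) (condLaw τ i D (D i) (!D i)) :=
        Finset.sum_le_sum fun i _ => hstep i
    _ = 4 * 𝔼 D, ∑ i, hellingerSq (condLaw τ i D false false) (condLaw τ i D (D i) (!D i)) := by
        rw [← Finset.mul_sum, Finset.expect_sum_comm]
    _ ≤ 4 * (4 * Real.log (Fintype.card T)) := by
        refine mul_le_mul_of_nonneg_left ?_ (by norm_num)
        exact Finset.expect_le Finset.univ_nonempty fun D _ => sum_hellingerSq_condLaw_le τ D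
    _ = 16 * Real.log (Fintype.card T) := by ring

/-- The total advantage with which a rectangular map distinguishes inputs that intersect exactly in
coordinate `i` from disjoint ones, over all `i`, is at most of order
`√(card ι * log (card T))`. -/
theorem sq_sum_advantage_le [Fintype T] (hτ : IsRectangular τ) (f : T → ℝ) (hf0 : ∀ t, 0 ≤ f t)
    (hf1 : ∀ t, f t ≤ 1) :
    (∑ i, 𝔼 D, 𝔼 z,
        (f (τ (update (aliceInput D z) i true) (update (bobInput D z) i true))
          - f (τ (update (aliceInput D z) i false) (update (bobInput D z) i false)))) ^ 2
      ≤ 64 * Fintype.card ι * Real.log (Fintype.card T) := by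
  let a : ι → (ι → Bool) → ℝ := fun i D => 𝔼 z,
    (f (τ (update (aliceInput D z) i true) (update (bobInput D z) i true))
      - f (τ (update (aliceInput D z) i false) (update (bobInput D z) i false)))
  have ha : ∀ i D, a i D ^ 2
      ≤ 4 * hellingerSq (condLaw τ i D false false) (condLaw τ i D true true) := fun i D => by
    refine le_trans ?_ (sq_sum_abs_sub_le_hellingerSq _ _ (condLaw_nonneg τ i D false false)
      (condLaw_nonneg τ i D true true) (sum_condLaw ..) (sum_condLaw ..))
    refine sq_le_sq.mpr ?_
    rw [abs_of_nonneg (a := ∑ t, |_|) (Finset.sum_nonneg fun t _ => abs_nonneg _)]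
    simp only [a]
    rw [Finset.expect_sub_distrib, ← sum_condLaw_mul, ← sum_condLaw_mul, abs_sub_comm,
      ← Finset.sum_sub_distrib]
    refine (Finset.abs_sum_le_sum_abs _ _).trans (Finset.sum_le_sum fun t _ => ?_)
    rw [← sub_mul, abs_mul, abs_of_nonneg (hf0 t)]
    exact mul_le_of_le_one_right (abs_nonneg _) (hf1 t)
  have hexp : ∀ i, (𝔼 D, a i D) ^ 2 ≤ 𝔼 D, a i D ^ 2 := fun i => by
    have h := Finset.expect_mul_sq_le_sq_mul_sq Finset.univ (a i) fun _ => 1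
    simpa [Fintype.expect_const] using h
  calc (∑ i, 𝔼 D, a i D) ^ 2 ≤ Fintype.card ι * ∑ i, (𝔼 D, a i D) ^ 2 := sq_sum_le_card_mul_sum_sq
    _ ≤ Fintype.card ι * ∑ i, 4 * 𝔼 D, hellingerSq (condLaw τ i D false false)
          (condLaw τ i D true true) := by
        refine mul_le_mul_of_nonneg_left (Finset.sum_le_sum fun i _ => ?_) (Nat.cast_nonneg _)
        rw [Finset.mul_expect]
        exact (hexp i).trans (Finset.expect_le_expect fun D _ => ha i D)
    _ ≤ Fintype.card ι * (4 * (16 * Real.log (Fintype.card T))) := by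
        rw [← Finset.mul_sum]
        refine mul_le_mul_of_nonneg_left ?_ (Nat.cast_nonneg _)
        exact mul_le_mul_of_nonneg_left (sum_expect_hellingerSq_le τ hτ) (by norm_num)
    _ = 64 * Fintype.card ι * Real.log (Fintype.card T) := by ring

end Disjointness

/-! ### Randomized lower bound for Set Disjointness -/

/-- Finitely many events of outer probability at most `ε` fail to be avoided, at some outcome, by
at most a proportion `ε` of them. -/
lemma exists_expect_indicator_le {Ω : Type u} [MeasurableSpace Ω] (μ : Measure Ω)
    [IsProbabilityMeasure μ] {J : Type} [Fintype J] [Nonempty J] (B : J → Set Ω) {ε : ℝ}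
    (hε : 0 ≤ ε) (hB : ∀ j, μ (B j) ≤ ENNReal.ofReal ε) :
    ∃ ω, 𝔼 j, (B j).indicator (fun _ => (1 : ℝ)) ω ≤ ε := by
  obtain ⟨ω, hω⟩ := exists_le_lintegral (μ := μ)
    (f := fun ω => ∑ j, (toMeasurable μ (B j)).indicator (fun _ => (1 : ENNReal)) ω)
    (Measurable.aemeasurable (Finset.measurable_sum _ fun j _ =>
      measurable_const.indicator (measurableSet_toMeasurable μ (B j))))
  refine ⟨ω, ?_⟩
  have hint : ∫⁻ ω, ∑ j, (toMeasurable μ (B j)).indicator (fun _ => (1 : ENNReal)) ω ∂μ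
      ≤ ENNReal.ofReal (Fintype.card J * ε) := by
    rw [lintegral_finsetSum _ fun j _ =>
      measurable_const.indicator (measurableSet_toMeasurable μ (B j))]
    calc ∑ j, ∫⁻ ω, (toMeasurable μ (B j)).indicator (fun _ => (1 : ENNReal)) ω ∂μ
        ≤ ∑ _j : J, ENNReal.ofReal ε := Finset.sum_le_sum fun j _ => by
          rw [lintegral_indicator_const (measurableSet_toMeasurable μ (B j)), one_mul,
            measure_toMeasurable]
          exact hB j
      _ = ENNReal.ofReal (Fintype.card J * ε) := by
          rw [ENNReal.ofReal_mul (Nat.cast_nonneg _)]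
          simp
  have hle : ENNReal.ofReal (∑ j, (B j).indicator (fun _ => (1 : ℝ)) ω)
      ≤ ENNReal.ofReal (Fintype.card J * ε) := by
    refine le_trans ?_ (hω.trans hint)
    rw [ENNReal.ofReal_sum_of_nonneg fun j _ => Set.indicator_nonneg (fun _ _ => zero_le_one) _]
    refine Finset.sum_le_sum fun j _ => ?_
    by_cases h : ω ∈ B j
    · simp [h, subset_toMeasurable μ (B j) h]
    · simp [h]
  have hle' := (ENNReal.ofReal_le_ofReal_iff (mul_nonneg (Nat.cast_nonneg _) hε)).mp hle
  rw [Fintype.expect_eq_sum_div_card, div_le_iff₀ (by exact_mod_cast Fintype.card_pos)]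
  linarith

/-- A random rectangular map from which disjoint and intersecting pairs of sets can be told apart
with error less than `1 / 2` takes exponentially many values. -/
theorem card_mul_sq_le_log_card_of_decides {ι T : Type} [Fintype ι] [DecidableEq ι] [Nonempty ι]
    [Fintype T] [DecidableEq T] {Ω : Type u} [MeasurableSpace Ω] (μ : Measure Ω)
    [IsProbabilityMeasure μ] (τ : Ω → (ι → Bool) → (ι → Bool) → T)
    (hτ : ∀ ω, IsRectangular (τ ω)) (out : T → Bool) {ε : ℝ} (hε : 0 ≤ ε) (hε' : ε ≤ 1 / 2)
    (hdisj : ∀ x y : ι → Bool, (∀ k, ¬(x k = true ∧ y k = true)) →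
      μ {ω | out (τ ω x y) ≠ false} ≤ ENNReal.ofReal ε)
    (hinter : ∀ x y : ι → Bool, (∃ k, x k = true ∧ y k = true) →
      μ {ω | out (τ ω x y) ≠ true} ≤ ENNReal.ofReal ε) :
    Fintype.card ι * (1 - 2 * ε) ^ 2 ≤ 64 * Real.log (Fintype.card T) := by
  let V := ι → Bool
  let x : ι → V → V → Bool → V := fun i D z b => update (aliceInput D z) i b
  let y : ι → V → V → Bool → V := fun i D z b => update (bobInput D z) i b
  let B : ι × V × V × Bool → Set Ω := fun j =>
    {ω | out (τ ω (x j.1 j.2.1 j.2.2.1 j.2.2.2) (y j.1 j.2.1 j.2.2.1 j.2.2.2)) ≠ j.2.2.2}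
  have hB : ∀ j, μ (B j) ≤ ENNReal.ofReal ε := by
    rintro ⟨i, D, z, b⟩
    cases b
    · refine hdisj _ _ fun k => ?_
      by_cases hk : k = i
      · subst hk; simp [x]
      · cases h : D k <;> simp [x, y, aliceInput, bobInput, hk, h]
    · exact hinter _ _ ⟨i, by simp [x, y]⟩
  obtain ⟨ω, hω⟩ := exists_expect_indicator_le μ B hε hB
  let f : T → ℝ := fun t => if out t then 1 else 0
  have hadv := sq_sum_advantage_le (τ ω) (hτ ω) f
    (fun t => by simp only [f]; split_ifs <;> norm_num)
    (fun t => by simp only [f]; split_ifs <;> norm_num)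
  have hbool : ∀ F : Bool → ℝ, 𝔼 b, F b = (F true + F false) / 2 := fun F => by
    rw [Fintype.expect_eq_sum_div_card]; simp
  have hterm : ∀ i D z, f (τ ω (x i D z true) (y i D z true))
      - f (τ ω (x i D z false) (y i D z false))
      = 1 - 2 * 𝔼 b, (B (i, D, z, b)).indicator (fun _ => (1 : ℝ)) ω := fun i D z => by
    rw [hbool]
    simp only [f, B, Set.indicator_apply, Set.mem_ofPred_eq]
    by_cases h1 : out (τ ω (x i D z true) (y i D z true)) = true <;>
      by_cases h2 : out (τ ω (x i D z false) (y i D z false)) = true <;> norm_num [h1, h2]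
  have hd : (0 : ℝ) < Fintype.card ι := by exact_mod_cast Fintype.card_pos
  have hsum : Fintype.card ι * (1 - 2 * ε) ≤ ∑ i, 𝔼 D, 𝔼 z,
      (f (τ ω (x i D z true) (y i D z true)) - f (τ ω (x i D z false) (y i D z false))) := by
    simp_rw [hterm, Finset.expect_sub_distrib, ← Finset.mul_expect]
    simp only [Fintype.expect_const, Finset.sum_sub_distrib, ← Finset.mul_sum]
    rw [← Finset.univ_product_univ, Finset.expect_product] at hω
    simp_rw [← Finset.univ_product_univ, Finset.expect_product] at hω
    rw [Fintype.expect_eq_sum_div_card, div_le_iff₀ hd] at hω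
    simp only [Finset.sum_const, Finset.card_univ, nsmul_eq_mul, mul_one]
    linarith
  have hsq := (pow_le_pow_left₀ (mul_nonneg hd.le (by linarith)) hsum 2).trans hadv
  refine le_of_mul_le_mul_left ?_ hd
  linarith

/-! ### Transcripts of protocols -/

namespace Protocol

variable {X Y Z : Type}

/-- The sequence of bits exchanged by the protocol on the input pair `(x, y)`. -/
def transcript : Protocol X Y Z → X → Y → List Bool
  | answerAlice _, _, _ => []
  | answerBob _, _, _ => []
  | sayAlice m next, x, y => m x :: transcript (next (m x)) x y
  | sayBob m next, x, y => m y :: transcript (next (m y)) x y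

lemma length_transcript (P : Protocol X Y Z) (x : X) (y : Y) :
    (P.transcript x y).length = P.bits x y := by
  induction P with
  | answerAlice g => rfl
  | answerBob g => rfl
  | sayAlice m next ih => simp [transcript, bits, ih]
  | sayBob m next ih => simp [transcript, bits, ih]

/-- The transcript together with a Boolean test of the answer has rectangular fibres. The test
matters because the answer is not determined by the transcript: it may depend on the input of the
party that gives it. -/
lemma transcript_run_rectangular (P : Protocol X Y Z) (h : Z → Bool) (x : X) (y : Y) (x' : X)
    (y' : Y) (ht : P.transcript x y = P.transcript x' y')
    (hr : h (P.run x y) = h (P.run x' y')) :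
    P.transcript x y' = P.transcript x y ∧ h (P.run x y') = h (P.run x y) := by
  induction P with
  | answerAlice g => exact ⟨rfl, rfl⟩
  | answerBob g => exact ⟨rfl, hr.symm⟩
  | sayAlice m next ih =>
    simp only [transcript, List.cons.injEq, run] at ht hr ⊢
    obtain ⟨hm, ht⟩ := ht
    rw [← hm] at ht hr
    obtain ⟨h1, h2⟩ := ih _ ht hr
    exact ⟨⟨trivial, h1⟩, h2⟩
  | sayBob m next ih =>
    simp only [transcript, List.cons.injEq, run] at ht hr ⊢
    obtain ⟨hm, ht⟩ := ht
    rw [← hm] at ht hr ⊢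
    obtain ⟨h1, h2⟩ := ih _ ht hr
    exact ⟨⟨rfl, h1⟩, h2⟩

/-- A Boolean test of the answer, together with the first `C` bits of the transcript; positions
beyond the end of the transcript are recorded as `none`. -/
def view (P : Protocol X Y Z) (h : Z → Bool) (C : ℕ) (x : X) (y : Y) :
    Bool × (Fin C → Option Bool) :=
  (h (P.run x y), fun k => (P.transcript x y)[(k : ℕ)]?)

lemma view_rectangular (P : Protocol X Y Z) (h : Z → Bool) (C : ℕ) (x : X) (y : Y) (x' : X)
    (y' : Y) (hxy : P.bits x y ≤ C) (hxy' : P.bits x' y' ≤ C)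
    (hv : P.view h C x y = P.view h C x' y') : P.view h C x y' = P.view h C x y := by
  rw [view, view, Prod.mk.injEq] at hv
  have ht : P.transcript x y = P.transcript x' y' := by
    refine List.ext_getElem? fun k => ?_
    by_cases hk : k < C
    · exact congrFun hv.2 ⟨k, hk⟩
    · rw [List.getElem?_eq_none (by rw [length_transcript]; omega),
        List.getElem?_eq_none (by rw [length_transcript]; omega)]
  obtain ⟨h1, h2⟩ := P.transcript_run_rectangular h x y x' y' ht hv.1
  rw [view, view, h1, h2]

end Protocol

/-! ### The Lasso optimum -/

section Lasso

variable {n d : ℕ}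

lemma lassoObjective_eq (M : Matrix (Fin n) (Fin d) ℝ) (b : Fin n → ℝ) (lam : ℝ)
    (z : Fin d → ℝ) :
    lassoObjective M b lam z = ∑ i, (M.mulVec z i - b i) ^ 2 + lam * ∑ j, |z j| := by
  rw [lassoObjective, EuclideanSpace.norm_sq_eq]
  simp [PiLp.norm_eq_of_L1]

lemma lassoObjective_nonneg (M : Matrix (Fin n) (Fin d) ℝ) (b : Fin n → ℝ) {lam : ℝ}
    (hlam : 0 ≤ lam) (z : Fin d → ℝ) : 0 ≤ lassoObjective M b lam z :=
  add_nonneg (sq_nonneg _) (mul_nonneg hlam (norm_nonneg _))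

lemma lassoOpt_nonneg (M : Matrix (Fin n) (Fin d) ℝ) (b : Fin n → ℝ) {lam : ℝ} (hlam : 0 ≤ lam) :
    0 ≤ lassoOpt M b lam :=
  Real.iInf_nonneg (lassoObjective_nonneg M b hlam)

lemma lassoOpt_le_of_mul_col_eq (M : Matrix (Fin n) (Fin d) ℝ) (b : Fin n → ℝ) {lam : ℝ}
    (hlam : 0 ≤ lam) (j : Fin d) (s : ℝ) (h : ∀ i, M i j * s = b i) :
    lassoOpt M b lam ≤ lam * |s| := by
  have hbdd : BddBelow (Set.range (lassoObjective M b lam)) :=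
    ⟨0, by rintro _ ⟨z, rfl⟩; exact lassoObjective_nonneg M b hlam z⟩
  refine (ciInf_le hbdd (Pi.single j s)).trans (le_of_eq ?_)
  rw [lassoObjective_eq]
  have h1 : ∀ i, M.mulVec (Pi.single j s) i - b i = 0 := fun i => by
    simp [Matrix.mulVec_single, h]
  have h2 : ∑ k, |(Pi.single j s : Fin d → ℝ) k| = |s| := by
    rw [Finset.sum_eq_single j]
    · simp
    · intro k _ hk; simp [hk]
    · simp
  simp only [h1, h2]
  simp

/-- If every column has `ℓ₁` norm at most `1` on a set `I` of rows with target value `1`, then each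
of these rows contributes at least `min_u (u - 1) ^ 2 + lam * |u| = lam - lam ^ 2 / 4`. -/
lemma card_mul_le_lassoOpt (M : Matrix (Fin n) (Fin d) ℝ) (b : Fin n → ℝ) {lam : ℝ}
    (hlam : 0 ≤ lam) (hlam1 : lam ≤ 1) (I : Finset (Fin n)) (hb : ∀ i ∈ I, b i = 1)
    (hM : ∀ j, ∑ i ∈ I, |M i j| ≤ 1) :
    #I * (3 * lam / 4) ≤ lassoOpt M b lam := by
  refine le_ciInf fun z => ?_
  rw [lassoObjective_eq]
  have h1 : ∑ i ∈ I, |M.mulVec z i| ≤ ∑ j, |z j| := by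
    calc ∑ i ∈ I, |M.mulVec z i| ≤ ∑ i ∈ I, ∑ j, |M i j| * |z j| := by
          refine Finset.sum_le_sum fun i _ => ?_
          simp_rw [← abs_mul]
          exact Finset.abs_sum_le_sum_abs (fun j => M i j * z j) Finset.univ
      _ = ∑ j, (∑ i ∈ I, |M i j|) * |z j| := by
          rw [Finset.sum_comm]
          simp_rw [Finset.sum_mul]
      _ ≤ ∑ j, |z j| :=
          Finset.sum_le_sum fun j _ => mul_le_of_le_one_left (abs_nonneg _) (hM j)
  have h2 : ∑ i ∈ I, (M.mulVec z i - b i) ^ 2 ≤ ∑ i, (M.mulVec z i - b i) ^ 2 :=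
    Finset.sum_le_sum_of_subset_of_nonneg (Finset.subset_univ I) fun i _ _ => sq_nonneg _
  calc #I * (3 * lam / 4) = ∑ _i ∈ I, 3 * lam / 4 := by simp
    _ ≤ ∑ i ∈ I, ((M.mulVec z i - b i) ^ 2 + lam * |M.mulVec z i|) := by
        refine Finset.sum_le_sum fun i hi => ?_
        rw [hb i hi]
        set u := M.mulVec z i
        nlinarith [sq_nonneg (u - 1 + lam / 2), le_abs_self u]
    _ = ∑ i ∈ I, (M.mulVec z i - b i) ^ 2 + lam * ∑ i ∈ I, |M.mulVec z i| := by
        rw [Finset.sum_add_distrib, Finset.mul_sum]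
    _ ≤ ∑ i, (M.mulVec z i - b i) ^ 2 + lam * ∑ j, |z j| :=
        add_le_add h2 (mul_le_mul_of_nonneg_left h1 hlam)

/-! ### Reductions from Set Disjointness -/

/-- If pairs of sets can be encoded as inputs of the parties such that the Lasso optimum is at most
`θ` for intersecting sets and at least `3 * θ / 2` for disjoint ones, then comparing a good
approximation with `6 * θ / 5` decides disjointness, so linearly many bits are needed. -/
theorem lassoRequiresBits_of_encoding
    {S : Set (Matrix (Fin n) (Fin d) ℝ × Matrix (Fin n) (Fin d) ℝ)} {b : Fin n → ℝ}
    {lam c ε θ : ℝ} (hlam : 0 ≤ lam) (hc : c ≤ 1 / 10) (hε : 0 < ε) (hε' : ε < 1 / 2)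
    (hθ : 0 < θ) (hd : 128 / (1 - 2 * ε) ^ 2 < d)
    (eA eB : (Fin d → Bool) → Matrix (Fin n) (Fin d) ℝ) (hS : ∀ x y, (eA x, eB y) ∈ S)
    (hdisj : ∀ x y, (∀ k, ¬(x k = true ∧ y k = true)) →
      3 * θ / 2 ≤ lassoOpt (eA x + eB y) b lam)
    (hinter : ∀ x y, (∃ k, x k = true ∧ y k = true) → lassoOpt (eA x + eB y) b lam ≤ θ) :
    LassoRequiresBits.{u} S b lam c ε ((1 - 2 * ε) ^ 2 / 256 * d) := by
  intro Ω _ μ _ P hP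
  by_contra! hbits
  have hδ : 0 < (1 - 2 * ε) ^ 2 := by
    have : 0 < 1 - 2 * ε := by linarith
    positivity
  set κ := (1 - 2 * ε) ^ 2 / 256 with hκ
  have hd0 : (0 : ℝ) < d := lt_trans (by positivity) hd
  have : Nonempty (Fin d) := ⟨⟨0, by exact_mod_cast hd0⟩⟩
  set C := ⌊κ * d⌋₊ with hC
  let h : ℝ → Bool := fun v => decide (v ≤ 6 * θ / 5)
  have hle : ∀ ω x y, (P ω).bits (eA x) (eB y) ≤ C := fun ω x y =>
    Nat.le_floor (hbits _ _ (hS x y) ω).le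
  have hopt : ∀ x y, c * lassoOpt (eA x + eB y) b lam ≤ lassoOpt (eA x + eB y) b lam / 10 :=
    fun x y => by nlinarith [lassoOpt_nonneg (eA x + eB y) b hlam]
  have hmain := card_mul_sq_le_log_card_of_decides μ
    (fun ω x y => (P ω).view h C (eA x) (eB y))
    (fun ω x y x' y' hv => (P ω).view_rectangular h C _ _ _ _ (hle ω x y) (hle ω x' y') hv)
    Prod.fst hε.le hε'.le
    (fun x y hxy => by
      refine (measure_mono fun ω hω => ?_).trans (hP _ _ (hS x y))
      intro hv
      have h1 := hdisj x y hxy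
      have h2 := abs_le.mp (hv.trans (hopt x y))
      refine hω (decide_eq_false ?_)
      linarith [h2.1])
    (fun x y hxy => by
      refine (measure_mono fun ω hω => ?_).trans (hP _ _ (hS x y))
      intro hv
      have h1 := hinter x y hxy
      have h2 := abs_le.mp (hv.trans (hopt x y))
      refine hω (decide_eq_true ?_)
      linarith [h2.2])
  have hcard : Real.log (Fintype.card (Bool × (Fin C → Option Bool))) ≤ 1 + 2 * (κ * d) := by
    have h1 : (Fintype.card (Bool × (Fin C → Option Bool)) : ℝ) = 2 * 3 ^ C := by simp
    rw [h1, Real.log_mul (by norm_num) (by positivity), Real.log_pow]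
    have h2 := Real.log_le_sub_one_of_pos (x := 2) (by norm_num)
    have h3 := Real.log_le_sub_one_of_pos (x := 3) (by norm_num)
    have h4 : (C : ℝ) ≤ κ * d := Nat.floor_le (by positivity)
    nlinarith [Nat.cast_nonneg (α := ℝ) C]
  rw [Fintype.card_fin] at hmain
  rw [div_lt_iff₀ hδ] at hd
  have hκ' : (1 - 2 * ε) ^ 2 = 256 * κ := by rw [hκ]; ring
  rw [hκ'] at hmain hd
  linarith

/-- The matrix whose row `0` is the indicator vector of `x` and whose other rows are zero. -/
def firstRowIndicator (n : ℕ) (x : Fin d → Bool) : Matrix (Fin n) (Fin d) ℝ :=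
  Matrix.of fun i j => if (i : ℕ) = 0 ∧ x j = true then 1 else 0

lemma lassoRequiresBits_binaryInputs {n : ℕ} (hn : 1 ≤ n) {lam c ε : ℝ} (hlam : 0 < lam)
    (hlam1 : lam < 1) (hc : c ≤ 1 / 10) (hε : 0 < ε) (hε' : ε < 1 / 2)
    (hd : 128 / (1 - 2 * ε) ^ 2 < d) :
    LassoRequiresBits.{u} (binaryInputs n d) (fun i => if (i : ℕ) = 0 then 1 else 0) lam c ε
      ((1 - 2 * ε) ^ 2 / 256 * d) := by
  refine lassoRequiresBits_of_encoding hlam.le hc hε hε' (θ := lam / 2) (by positivity) hd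
    (firstRowIndicator n) (firstRowIndicator n) ?_ ?_ ?_
  · have h01 : ∀ (x : Fin d → Bool) i j,
        firstRowIndicator n x i j = 0 ∨ firstRowIndicator n x i j = 1 := fun x i j => by
      simp only [firstRowIndicator, Matrix.of_apply]
      split_ifs <;> simp
    exact fun x y => ⟨h01 x, h01 y⟩
  · intro x y hxy
    have h := card_mul_le_lassoOpt (firstRowIndicator n x + firstRowIndicator n y)
      (fun i => if (i : ℕ) = 0 then 1 else 0) hlam.le hlam1.le {⟨0, hn⟩} (by simp) fun j => by
        have := hxy j
        rw [Finset.sum_singleton, Matrix.add_apply]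
        simp only [firstRowIndicator, Matrix.of_apply, true_and]
        split_ifs with h1 h2
        · exact absurd ⟨h1, h2⟩ this
        all_goals norm_num
    rw [Finset.card_singleton] at h
    push_cast at h
    linarith
  · rintro x y ⟨k, hx, hy⟩
    have h := lassoOpt_le_of_mul_col_eq (firstRowIndicator n x + firstRowIndicator n y)
      (fun i => if (i : ℕ) = 0 then 1 else 0) hlam.le k (1 / 2) fun i => by
        rw [Matrix.add_apply]
        simp only [firstRowIndicator, Matrix.of_apply, hx, hy, and_true]
        split_ifs <;> norm_num
    rw [abs_of_pos (by norm_num)] at h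
    linarith

lemma lassoOpt_rowIndicator_le {lam : ℝ} (hlam : 0 < lam) {A B : Finset (Fin d)}
    (h : (A ∩ B).Nonempty) :
    lassoOpt (rowIndicator 0 A + rowIndicator 1 B) (fun _ => 1) lam ≤ lam := by
  obtain ⟨k, hk⟩ := h
  rw [Finset.mem_inter] at hk
  have h := lassoOpt_le_of_mul_col_eq (rowIndicator 0 A + rowIndicator 1 B) (fun _ => 1)
    hlam.le k 1 fun i => by
      fin_cases i <;> simp [rowIndicator, hk]
  simpa using h

lemma le_lassoOpt_rowIndicator {lam : ℝ} (hlam : 0 < lam) (hlam1 : lam < 1)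
    {A B : Finset (Fin d)} (h : A ∩ B = ∅) :
    3 * lam / 2 ≤ lassoOpt (rowIndicator 0 A + rowIndicator 1 B) (fun _ => 1) lam := by
  have h := card_mul_le_lassoOpt (rowIndicator 0 A + rowIndicator 1 B) (fun _ => 1) hlam.le
    hlam1.le Finset.univ (fun _ _ => rfl) fun j => by
      have hj : ¬(j ∈ A ∧ j ∈ B) := by rw [← Finset.mem_inter, h]; simp
      rw [Fin.sum_univ_two]
      by_cases hA : j ∈ A <;> by_cases hB : j ∈ B <;> simp_all [rowIndicator]
  rw [Finset.card_univ, Fintype.card_fin] at h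
  push_cast at h
  linarith

lemma lassoRequiresBits_disjointnessInputs {lam c ε : ℝ} (hlam : 0 < lam) (hlam1 : lam < 1)
    (hc : c ≤ 1 / 10) (hε : 0 < ε) (hε' : ε < 1 / 2) (hd : 128 / (1 - 2 * ε) ^ 2 < d) :
    LassoRequiresBits.{u} (disjointnessInputs d) (fun _ => 1) lam c ε
      ((1 - 2 * ε) ^ 2 / 256 * d) := by
  refine lassoRequiresBits_of_encoding hlam.le hc hε hε' hlam hd
    (fun x => rowIndicator 0 {k | x k = true}) (fun y => rowIndicator 1 {k | y k = true})
    (fun x y => ⟨_, _, rfl⟩) ?_ ?_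
  · intro x y hxy
    refine le_lassoOpt_rowIndicator hlam hlam1 (Finset.eq_empty_of_forall_notMem fun k hk => ?_)
    simp only [Finset.mem_inter, Finset.mem_filter, Finset.mem_univ, true_and] at hk
    exact hxy k hk
  · rintro x y ⟨k, hk⟩
    refine lassoOpt_rowIndicator_le hlam ⟨k, ?_⟩
    simpa using hk

end Lasso

theorem mainTheorem7 :
    (∃ c₀ : ℝ, 0 < c₀ ∧ ∀ ε : ℝ, 0 < ε → ε < 1 / 2 →
      ∃ κ : ℝ, 0 < κ ∧ ∃ d₀ : ℕ,
        (∀ n : ℕ, 1 ≤ n → ∃ b : Fin n → ℝ, (∀ i, b i = 0 ∨ b i = 1) ∧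
          ∀ lam : ℝ, 0 < lam → lam < 1 → ∀ c : ℝ, 0 < c → c ≤ c₀ → ∀ d : ℕ, d₀ ≤ d →
            LassoRequiresBits.{u} (binaryInputs n d) b lam c ε (κ * d)) ∧
        (∀ lam : ℝ, 0 < lam → lam < 1 → ∀ c : ℝ, 0 < c → c ≤ c₀ → ∀ d : ℕ, d₀ ≤ d →
            LassoRequiresBits.{u} (disjointnessInputs d) (fun _ => 1) lam c ε (κ * d))) ∧
    (∀ lam : ℝ, 0 < lam → lam < 1 → ∀ (d : ℕ) (A B : Finset (Fin d)),
      ((A ∩ B).Nonempty →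
        lassoOpt (rowIndicator 0 A + rowIndicator 1 B) (fun _ => 1) lam ≤ lam) ∧
      (A ∩ B = ∅ →
        3 * lam / 2 ≤ lassoOpt (rowIndicator 0 A + rowIndicator 1 B) (fun _ => 1) lam)) := by
  refine ⟨⟨1 / 10, by norm_num, fun ε hε hε' => ?_⟩, fun lam hlam hlam1 d A B =>
    ⟨lassoOpt_rowIndicator_le hlam, le_lassoOpt_rowIndicator hlam hlam1⟩⟩
  have hδ : 0 < 1 - 2 * ε := by linarith
  have hd : ∀ d : ℕ, ⌊128 / (1 - 2 * ε) ^ 2⌋₊ + 1 ≤ d → 128 / (1 - 2 * ε) ^ 2 < (d : ℝ) :=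
    fun d h => (Nat.lt_floor_add_one _).trans_le (by exact_mod_cast h)
  refine ⟨(1 - 2 * ε) ^ 2 / 256, by positivity, ⌊128 / (1 - 2 * ε) ^ 2⌋₊ + 1, fun n hn => ?_, ?_⟩
  · exact ⟨fun i => if (i : ℕ) = 0 then 1 else 0, fun i => by dsimp only; split_ifs <;> simp,
      fun lam hlam hlam1 c _ hc d h =>
        lassoRequiresBits_binaryInputs hn hlam hlam1 hc hε hε' (hd d h)⟩
  · exact fun lam hlam hlam1 c _ hc d h =>
      lassoRequiresBits_disjointnessInputs hlam hlam1 hc hε hε' (hd d h)
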